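/- Let $X$ be a Tychonoff space with Stone–Čech compactification $\beta X$, and let $\upsilon X\subseteq\beta X$ be its Hewitt realcompactification, i.e. the set of all $p\in\beta X$ such that for every continuous $f:X\to\mathbb{R}$ the continuous extension $\beta X\to\mathbb{R}\cup\{\infty\}$ of $f$ is finite at $p$. Define the subspaces \[\alpha X=X\cup(\beta X\setminus\upsilon X),\qquad \zeta X=X\cup\mathrm{cl}_{\beta X}(\beta X\setminus\upsilon X)\] of $\beta X$. A space is pseudocompact if every continuous real-valued function on it is bounded; zero-sets and cozero-sets of $X$ are the sets $\{x: f(x)=0\}$ and $\{x: f(x)\neq 0\}$ with $f:X\to\mathbb{R}$ continuous; a $z$-ultrafilter in $X$ is a maximal proper filter of zero-sets of $X$, and it is free if its intersection is empty. Then: (1) $\zeta X=X$ if and only if $X$ is pseudocompact. (2) $\zeta X=\beta X$ if and only if there exists no cozero-set of $X$ with pseudocompact closure (in $X$) containing a non-compact zero-set of $X$. (3) The following are equivalent: (a) $\zeta X=\alpha X$; (b) $\upsilon X\setminus X\subseteq\mathrm{int}_{\beta X}\upsilon X$; (c) every free $z$-ultrafilter in $X$ with the countable intersection property has an element contained in a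 cozero-set of $X$ with pseudocompact closure. -/

import Mathlib

universe u

/-- A space is pseudocompact if every continuous real-valued function on it is bounded. -/
def IsPseudocompactSpace (X : Type u) [TopologicalSpace X] : Prop :=
  ∀ f : C(X, ℝ), Bornology.IsBounded (Set.range f)

/-- A zero-set of `X`. -/
def IsZeroSet {X : Type u} [TopologicalSpace X] (Z : Set X) : Prop :=
  ∃ f : C(X, ℝ), Z = {x | f x = 0}

/-- A cozero-set of `X`. -/
def IsCozeroSet {X : Type u} [TopologicalSpace X] (C : Set X) : Prop :=
  ∃ f : C(X, ℝ), C = {x | f x ≠ 0}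

/-- A cozero-set of `X` whose closure in `X`, with the subspace topology, is pseudocompact. -/
def IsCozeroSetWithPseudocompactClosure {X : Type u} [TopologicalSpace X] (C : Set X) : Prop :=
  IsCozeroSet C ∧ IsPseudocompactSpace (closure C)

/-- A (proper) z-filter in `X`: a nonempty family of nonempty zero-sets of `X`, closed under
finite intersections and under passing to larger zero-sets. -/
structure IsZFilter {X : Type u} [TopologicalSpace X] (F : Set (Set X)) : Prop where
  isZeroSet : ∀ Z ∈ F, IsZeroSet Z
  nonempty : F.Nonempty
  empty_notMem : ∅ ∉ F
  inter_mem : ∀ Z ∈ F, ∀ W ∈ F, Z ∩ W ∈ F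
  mem_of_superset : ∀ Z ∈ F, ∀ W, IsZeroSet W → Z ⊆ W → W ∈ F

/-- A z-ultrafilter in `X`: a z-filter that is maximal under inclusion. -/
def IsZUltrafilter {X : Type u} [TopologicalSpace X] (F : Set (Set X)) : Prop :=
  Maximal IsZFilter F

/-- A family of sets is free if its intersection is empty. -/
def IsFreeFamily {X : Type u} (F : Set (Set X)) : Prop :=
  ⋂₀ F = ∅

/-- The countable intersection property. -/
def HasCountableIntersectionProperty {X : Type u} (F : Set (Set X)) : Prop :=
  ∀ S : Set (Set X), S ⊆ F → S.Countable → (⋂₀ S).Nonempty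

section Extensions

variable (X : Type u) [TopologicalSpace X]

/-- The canonical copy of `X` in its Stone–Čech compactification `βX`. -/
def copyInBeta : Set (StoneCech X) :=
  Set.range (stoneCechUnit : X → StoneCech X)

variable {X} in
/-- The Stone extension `βX → ℝ ∪ {∞}` of a continuous function `f : X → ℝ`, where
`ℝ ∪ {∞}` is the one-point compactification of `ℝ`. -/
noncomputable def stoneExtension (f : C(X, ℝ)) : StoneCech X → OnePoint ℝ :=
  stoneCechExtend (g := fun x => (f x : OnePoint ℝ))
    (OnePoint.continuous_coe.comp f.continuous)

/-- The Hewitt realcompactification `υX` as a subspace of `βX`: the points at which the Stone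
extension of every continuous real-valued function on `X` is finite. -/
def hewittRealcompactification : Set (StoneCech X) :=
  {p | ∀ f : C(X, ℝ), stoneExtension f p ≠ OnePoint.infty}

/-- `αX = X ∪ (βX \ υX)`, as a subspace of `βX`. -/
def alphaExtension : Set (StoneCech X) :=
  copyInBeta X ∪ (hewittRealcompactification X)ᶜ

/-- `ζX = X ∪ cl_{βX} (βX \ υX)`, as a subspace of `βX`. -/
def zetaExtension : Set (StoneCech X) :=
  copyInBeta X ∪ closure (hewittRealcompactification X)ᶜ

end Extensions

/-!
Everything is read off from points of `βX`. The z-ultrafilters in `X` are the families of zero-sets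
whose closure in `βX` contains a given `p` (Gelfand–Kolmogorov); such a family is free iff `p ∉ X`,
and it has the countable intersection property iff every zero-set of `βX` through `p` meets `X`,
that is, iff `p ∈ υX`.

A function `f` is bounded on `S ⊆ X` iff its Stone extension omits `∞` on the closure of `S` in
`βX`, so that closure lies in `υX` iff every `f` is bounded on `S`. For a cozero-set `S` this is
pseudocompactness of the closure of `S` in `X`. Hence `p` is interior to `υX` iff the family at `p`
has a member inside a cozero-set with pseudocompact closure, and all three claims follow by
comparing `X`, `υX` and the interior of `υX`.
-/

open Bornology Filter Set Topology

universe v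

section ZeroSets

variable {X : Type u} {Y : Type v} [TopologicalSpace X] [TopologicalSpace Y]

lemma IsZeroSet.isClosed {Z : Set X} (hZ : IsZeroSet Z) : IsClosed Z := by
  obtain ⟨f, rfl⟩ := hZ
  exact isClosed_eq f.continuous continuous_const

lemma IsZeroSet.preimage {Z : Set Y} (hZ : IsZeroSet Z) {φ : X → Y} (hφ : Continuous φ) :
    IsZeroSet (φ ⁻¹' Z) := by
  obtain ⟨f, rfl⟩ := hZ
  exact ⟨f.comp ⟨φ, hφ⟩, rfl⟩

lemma isZeroSet_of_isClosed [TopologicalSpace.MetrizableSpace X] {Z : Set X} (hZ : IsClosed Z) :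
    IsZeroSet Z := by
  let := TopologicalSpace.metrizableSpaceMetric X
  rcases Z.eq_empty_or_nonempty with rfl | hne
  · exact ⟨1, by simp⟩
  · exact ⟨⟨fun x => Metric.infDist x Z, Metric.continuous_infDist_pt Z⟩,
      Set.ext fun x => hZ.mem_iff_infDist_zero hne⟩

lemma IsZeroSet.iInter {ι : Type*} [Countable ι] {Z : ι → Set X} (hZ : ∀ i, IsZeroSet (Z i)) :
    IsZeroSet (⋂ i, Z i) := by
  choose f hf using hZ
  -- `⋂ i, Z i` is the zero-set of the evaluation map into the metrizable space `ι → ℝ`.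
  have h : IsZeroSet ((fun x i => f i x) ⁻¹' {(0 : ι → ℝ)}) :=
    (isZeroSet_of_isClosed isClosed_singleton).preimage (by fun_prop)
  convert h
  ext x
  simp [hf, funext_iff]

lemma IsZeroSet.inter {Z W : Set X} (hZ : IsZeroSet Z) (hW : IsZeroSet W) : IsZeroSet (Z ∩ W) := by
  rw [inter_eq_iInter]
  exact IsZeroSet.iInter (Bool.forall_bool.2 ⟨hW, hZ⟩)

lemma isZeroSet_compl_iff {C : Set X} : IsZeroSet Cᶜ ↔ IsCozeroSet C :=
  exists_congr fun f => by rw [compl_eq_comm, eq_comm]; rfl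

lemma IsCozeroSet.preimage {C : Set Y} (hC : IsCozeroSet C) {φ : X → Y} (hφ : Continuous φ) :
    IsCozeroSet (φ ⁻¹' C) :=
  isZeroSet_compl_iff.1 ((isZeroSet_compl_iff.2 hC).preimage hφ)

lemma IsZeroSet.exists_continuous_zero_one {Z W : Set X} (hZ : IsZeroSet Z) (hW : IsZeroSet W)
    (hZW : Disjoint Z W) :
    ∃ k : C(X, ℝ), EqOn k 0 Z ∧ EqOn k 1 W ∧ ∀ x, k x ∈ Icc (0 : ℝ) 1 := by
  obtain ⟨f, rfl⟩ := hZ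
  obtain ⟨g, rfl⟩ := hW
  have hpos (x : X) : 0 < |f x| + |g x| := by
    by_cases hx : f x = 0
    · have : g x ≠ 0 := fun h => hZW.le_bot ⟨hx, h⟩
      positivity
    · positivity
  refine ⟨⟨fun x => |f x| / (|f x| + |g x|),
    Continuous.div (by fun_prop) (by fun_prop) fun x => (hpos x).ne'⟩, ?_, ?_, fun x => ⟨?_, ?_⟩⟩
  · intro x hx
    simp [show f x = 0 from hx]
  · intro x hx
    have hgx : g x = 0 := hx
    simpa [hgx] using (hpos x).ne'
  · exact div_nonneg (abs_nonneg _) (hpos x).le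
  · exact div_le_one_of_le₀ (le_add_of_nonneg_right (abs_nonneg _)) (hpos x).le

lemma exists_isZeroSet_subset_isCozeroSet_of_mem_nhds [CompletelyRegularSpace X] {p : X} {U : Set X}
    (hU : U ∈ 𝓝 p) :
    ∃ V ∈ 𝓝 p, ∃ C, IsZeroSet V ∧ IsCozeroSet C ∧ V ⊆ C ∧ closure C ⊆ U := by
  obtain ⟨f, hf, hfp, hfU⟩ := CompletelyRegularSpace.completely_regular_isOpen p (interior U)
    isOpen_interior (mem_interior_iff_mem_nhds.2 hU)
  have hf' : Continuous fun x => (f x : ℝ) := by fun_prop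
  refine ⟨{x | (f x : ℝ) ≤ 1 / 3}, hf'.continuousAt.eventually (ge_mem_nhds (by norm_num [hfp])),
    {x | (f x : ℝ) < 2 / 3}, (isZeroSet_of_isClosed isClosed_Iic).preimage hf',
    isZeroSet_compl_iff.1 ((isZeroSet_of_isClosed isOpen_Iio.isClosed_compl).preimage hf'),
    fun x hx => lt_of_le_of_lt (show (f x : ℝ) ≤ 1 / 3 from hx) (by norm_num),
    fun x hx => interior_subset ?_⟩
  have hx : (f x : ℝ) ≤ 2 / 3 := closure_lt_subset_le hf' continuous_const hx
  by_contra hxU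
  norm_num [hfU hxU] at hx

lemma exists_isZeroSet_subset_of_mem_nhds [CompletelyRegularSpace X] {p : X} {U : Set X}
    (hU : U ∈ 𝓝 p) : ∃ V ∈ 𝓝 p, IsZeroSet V ∧ V ⊆ U := by
  obtain ⟨V, hVp, C, hV, -, hVC, hCU⟩ := exists_isZeroSet_subset_isCozeroSet_of_mem_nhds hU
  exact ⟨V, hVp, hV, (hVC.trans subset_closure).trans hCU⟩

end ZeroSets

section StoneCechExtensions

variable {X : Type u} [TopologicalSpace X]

lemma exists_continuousMap_stoneCech_extending {f : C(X, ℝ)} (hf : IsBounded (range f)) :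
    ∃ F : C(StoneCech X, ℝ), ∀ x, F (stoneCechUnit x) = f x := by
  have : CompactSpace (closure (range f)) := isCompact_iff_compactSpace.1 hf.isCompact_closure
  have hg : Continuous fun x => (⟨f x, subset_closure (mem_range_self x)⟩ : closure (range f)) := by
    fun_prop
  exact ⟨⟨fun q => (stoneCechExtend hg q : closure (range f)),
      (continuous_stoneCechExtend hg).subtype_val⟩,
    fun x => congrArg Subtype.val (stoneCechExtend_stoneCechUnit hg x)⟩

lemma IsZeroSet.exists_preimage_stoneCechUnit_eq {Z : Set X} (hZ : IsZeroSet Z) :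
    ∃ Z' : Set (StoneCech X), IsZeroSet Z' ∧ stoneCechUnit ⁻¹' Z' = Z := by
  obtain ⟨f, rfl⟩ := hZ
  let g : C(X, ℝ) := ⟨fun x => min |f x| 1, by fun_prop⟩
  have hg : IsBounded (range g) := (Metric.isBounded_Icc 0 1).subset <| range_subset_iff.2 fun x =>
    ⟨le_min (abs_nonneg _) zero_le_one, min_le_right _ _⟩
  obtain ⟨F, hF⟩ := exists_continuousMap_stoneCech_extending hg
  refine ⟨{q | F q = 0}, ⟨F, rfl⟩, ?_⟩
  ext x
  have hmin : min |f x| 1 = 0 ↔ f x = 0 := by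
    rw [← abs_eq_zero (a := f x)]
    grind
  simpa [hF, g] using hmin

lemma IsZeroSet.preimage_closure_image_stoneCechUnit {Z : Set X} (hZ : IsZeroSet Z) :
    stoneCechUnit ⁻¹' closure (stoneCechUnit '' Z) = Z := by
  obtain ⟨Z', hZ', rfl⟩ := hZ.exists_preimage_stoneCechUnit_eq
  exact (preimage_mono (closure_minimal (image_preimage_subset _ _) hZ'.isClosed)).antisymm
    fun x hx => subset_closure (mem_image_of_mem _ hx)

lemma IsZeroSet.isCompact_iff_closure_image_subset [CompletelyRegularSpace X] {Z : Set X}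
    (hZ : IsZeroSet Z) : IsCompact Z ↔ closure (stoneCechUnit '' Z) ⊆ copyInBeta X := by
  constructor <;> intro h
  · rw [(h.image continuous_stoneCechUnit).isClosed.closure_eq]
    exact image_subset_range _ _
  · rw [isInducing_stoneCechUnit.isCompact_iff, ← hZ.preimage_closure_image_stoneCechUnit,
      image_preimage_eq_of_subset h]
    exact isClosed_closure.isCompact

lemma IsZeroSet.disjoint_closure_image_stoneCechUnit {Z W : Set X} (hZ : IsZeroSet Z)
    (hW : IsZeroSet W) (hZW : Disjoint Z W) :
    Disjoint (closure (stoneCechUnit '' Z)) (closure (stoneCechUnit '' W)) := by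
  obtain ⟨k, hk0, hk1, hk⟩ := hZ.exists_continuous_zero_one hW hZW
  obtain ⟨F, hF⟩ := exists_continuousMap_stoneCech_extending
    ((Metric.isBounded_Icc 0 1).subset (range_subset_iff.2 hk))
  have hF0 : closure (stoneCechUnit '' Z) ⊆ F ⁻¹' {0} :=
    closure_minimal (image_subset_iff.2 fun x hx => (hF x).trans (hk0 hx))
      (isClosed_singleton.preimage F.continuous)
  have hF1 : closure (stoneCechUnit '' W) ⊆ F ⁻¹' {1} :=
    closure_minimal (image_subset_iff.2 fun x hx => (hF x).trans (hk1 hx))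
      (isClosed_singleton.preimage F.continuous)
  exact (Disjoint.preimage F (by simp)).mono hF0 hF1

lemma mem_closure_image_inter_preimage_of_mem_nhds {S : Set X} {V : Set (StoneCech X)}
    {p : StoneCech X} (hp : p ∈ closure (stoneCechUnit '' S)) (hV : V ∈ 𝓝 p) :
    p ∈ closure (stoneCechUnit '' (S ∩ stoneCechUnit ⁻¹' V)) := by
  rw [image_inter_preimage, mem_closure_iff_frequently] at *
  exact hp.and_eventually hV

lemma IsZeroSet.closure_image_inter {Z W : Set X} (hZ : IsZeroSet Z) (hW : IsZeroSet W) :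
    closure (stoneCechUnit '' (Z ∩ W)) =
      closure (stoneCechUnit '' Z) ∩ closure (stoneCechUnit '' W) := by
  refine ((closure_mono (image_inter_subset _ _ _)).trans
    (closure_inter_subset_inter_closure _ _)).antisymm ?_
  rintro p ⟨hpZ, hpW⟩
  by_contra hp
  obtain ⟨V, hVp, hV, hVU⟩ :=
    exists_isZeroSet_subset_of_mem_nhds (isClosed_closure.isOpen_compl.mem_nhds hp)
  have hdisj : Disjoint (Z ∩ stoneCechUnit ⁻¹' V) W := disjoint_left.2 fun x hx hxW =>
    hVU hx.2 (subset_closure (mem_image_of_mem _ ⟨hx.1, hxW⟩))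
  exact ((hZ.inter (hV.preimage continuous_stoneCechUnit)).disjoint_closure_image_stoneCechUnit
    hW hdisj).le_bot ⟨mem_closure_image_inter_preimage_of_mem_nhds hpZ hVp, hpW⟩

end StoneCechExtensions

section Hewitt

variable {X : Type u} [TopologicalSpace X]

lemma continuous_stoneExtension (f : C(X, ℝ)) : Continuous (stoneExtension f) :=
  continuous_stoneCechExtend _

lemma stoneExtension_stoneCechUnit (f : C(X, ℝ)) (x : X) :
    stoneExtension f (stoneCechUnit x) = (f x : OnePoint ℝ) :=
  stoneCechExtend_stoneCechUnit _ x

lemma copyInBeta_subset_hewittRealcompactification :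
    copyInBeta X ⊆ hewittRealcompactification X := by
  rintro _ ⟨x, rfl⟩ f
  rw [stoneExtension_stoneCechUnit]
  exact OnePoint.coe_ne_infty _

lemma isZeroSet_preimage_stoneExtension_infty (f : C(X, ℝ)) :
    IsZeroSet (stoneExtension f ⁻¹' {OnePoint.infty}) := by
  -- `ℝ ∪ {∞}` is a circle.
  have : TopologicalSpace.MetrizableSpace (OnePoint ℝ) :=
    (onePointEquivSphereOfFinrankEq (ι := Fin 2) (by simp)).isEmbedding.metrizableSpace
  exact (isZeroSet_of_isClosed isClosed_singleton).preimage (continuous_stoneExtension f)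

lemma stoneExtension_eq_infty_of_forall_mul_eq_one {f : C(X, ℝ)} {h : C(StoneCech X, ℝ)}
    (hfh : ∀ x, f x * h (stoneCechUnit x) = 1) {p : StoneCech X} (hp : h p = 0) :
    stoneExtension f p = OnePoint.infty := by
  by_contra hinf
  obtain ⟨r, hr⟩ := OnePoint.ne_infty_iff_exists.1 hinf
  have : (comap (stoneCechUnit : X → StoneCech X) (𝓝 p)).NeBot :=
    comap_neBot_iff_frequently.2 (mem_closure_iff_frequently.1 (denseRange_stoneCechUnit p))
  have hf : Tendsto f (comap stoneCechUnit (𝓝 p)) (𝓝 r) := by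
    rw [OnePoint.isOpenEmbedding_coe.isInducing.tendsto_nhds_iff, hr]
    exact (((continuous_stoneExtension f).tendsto p).comp tendsto_comap).congr
      (stoneExtension_stoneCechUnit f)
  have hh : Tendsto (h ∘ stoneCechUnit) (comap stoneCechUnit (𝓝 p)) (𝓝 0) :=
    hp ▸ (h.continuous.tendsto p).comp tendsto_comap
  have h01 : r * 0 = 1 :=
    tendsto_nhds_unique (hf.mul hh) (tendsto_const_nhds.congr fun x => (hfh x).symm)
  simp at h01

lemma mem_hewittRealcompactification_iff {p : StoneCech X} :
    p ∈ hewittRealcompactification X ↔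
      ∀ Z, IsZeroSet Z → p ∈ Z → (Z ∩ copyInBeta X).Nonempty := by
  constructor
  · rintro hp _ ⟨h, rfl⟩ hpZ
    by_contra hempty
    have hne (x : X) : h (stoneCechUnit x) ≠ 0 := fun hx => hempty ⟨_, hx, x, rfl⟩
    exact hp ⟨fun x => (h (stoneCechUnit x))⁻¹,
        (h.continuous.comp continuous_stoneCechUnit).inv₀ hne⟩
      (stoneExtension_eq_infty_of_forall_mul_eq_one (fun x => inv_mul_cancel₀ (hne x)) hpZ)
  · intro h f hf
    obtain ⟨_, hx, x, rfl⟩ := h _ (isZeroSet_preimage_stoneExtension_infty f) hf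
    exact OnePoint.coe_ne_infty _ ((stoneExtension_stoneCechUnit f x).symm.trans hx)

end Hewitt

section Pseudocompact

variable {X : Type u} [TopologicalSpace X]

/-- Relative pseudocompactness of a subset `S` of `X`: every continuous real-valued function on all
of `X` is bounded on `S`. -/
def IsRelativelyPseudocompact (S : Set X) : Prop :=
  ∀ f : C(X, ℝ), IsBounded (f '' S)

lemma infty_mem_closure_image_coe_iff {Y : Type v} [PseudoMetricSpace Y] [ProperSpace Y]
    {S : Set Y} :
    OnePoint.infty ∈ closure ((↑) '' S : Set (OnePoint Y)) ↔ ¬IsBounded S := by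
  have hcobounded : (∃ᶠ y in cobounded Y, y ∈ S) ↔ ¬IsBounded S := by
    rw [isBounded_def]
    rfl
  simp [mem_closure_iff_frequently, OnePoint.nhds_infty_eq, frequently_sup, ← hcobounded,
    Metric.cobounded_eq_cocompact]

lemma closure_image_subset_hewittRealcompactification_iff {S : Set X} :
    closure (stoneCechUnit '' S) ⊆ hewittRealcompactification X ↔ IsRelativelyPseudocompact S := by
  have himage (f : C(X, ℝ)) :
      stoneExtension f '' closure (stoneCechUnit '' S) = closure ((↑) '' (f '' S)) := by
    rw [← (continuous_stoneExtension f).isClosedMap.closure_image_eq_of_continuous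
      (continuous_stoneExtension f), image_image, image_image]
    simp only [stoneExtension_stoneCechUnit]
  have hbdd (f : C(X, ℝ)) : IsBounded (f '' S) ↔
      ∀ p ∈ closure (stoneCechUnit '' S), stoneExtension f p ≠ OnePoint.infty := by
    rw [← not_iff_not, ← infty_mem_closure_image_coe_iff, ← himage]
    simp [mem_image]
  simp only [IsRelativelyPseudocompact, hbdd]
  exact ⟨fun h f p hp => h hp f, fun h p hp f => h f p hp⟩

lemma isPseudocompactSpace_iff_hewittRealcompactification_eq_univ :
    IsPseudocompactSpace X ↔ hewittRealcompactification X = univ := by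
  rw [← univ_subset_iff, ← denseRange_stoneCechUnit.closure_range, ← image_univ,
    closure_image_subset_hewittRealcompactification_iff]
  simp only [IsRelativelyPseudocompact, IsPseudocompactSpace, image_univ]

lemma exists_continuous_ge_of_monotone {a : ℝ → ℝ} (ha : Monotone a) :
    ∃ F : C(ℝ, ℝ), ∀ t, a t ≤ F t :=
  exists_continuous_forall_mem_convex_of_local_const (t := fun t => Ici (a t))
    (fun t => convex_Ici (a t)) fun t =>
      ⟨a (t + 1), mem_of_superset (Iio_mem_nhds (lt_add_one t)) fun _ hs => ha (le_of_lt hs)⟩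

lemma exists_continuous_ge_of_natCast_le (b : ℕ → ℝ) :
    ∃ F : C(ℝ, ℝ), ∀ (n : ℕ) (t : ℝ), n ≤ t → b n ≤ F t := by
  have hmono : Monotone fun t : ℝ => ∑ i ∈ Finset.range (⌊t⌋₊ + 1), |b i| := fun s t hst =>
    Finset.sum_le_sum_of_subset_of_nonneg (by gcongr) fun _ _ _ => abs_nonneg _
  obtain ⟨F, hF⟩ := exists_continuous_ge_of_monotone hmono
  refine ⟨F, fun n t hnt => (le_abs_self _).trans (le_trans ?_ (hF t))⟩
  exact Finset.single_le_sum (f := fun i => |b i|) (fun _ _ => abs_nonneg _)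
    (Finset.mem_range_succ_iff.2 (Nat.le_floor hnt))

lemma exists_continuous_eq_mul_of_closure_support (g : C(X, ℝ))
    (f : C(closure {x | g x ≠ 0}, ℝ)) :
    ∃ h : C(X, ℝ), ∀ x : closure {x | g x ≠ 0}, h x = f x * g x := by
  let h : X → ℝ := Function.extend Subtype.val f 0 * g
  have hfg (x : closure {x | g x ≠ 0}) : h x = f x * g x := by
    simp [h]
  have hsupport : ContinuousOn h (closure {x | g x ≠ 0}) := by
    rw [continuousOn_iff_continuous_domRestrict]
    exact (by fun_prop : Continuous fun x : closure {x | g x ≠ 0} => f x * g x).congr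
      fun x => (hfg x).symm
  have hzero : ContinuousOn h {x | g x = 0} :=
    (continuousOn_const (c := (0 : ℝ))).congr fun x hx => by simp [h, show g x = 0 from hx]
  have hcover : closure {x | g x ≠ 0} ∪ {x | g x = 0} = univ :=
    eq_univ_of_forall fun x => (em (g x = 0)).symm.imp (subset_closure ·) id
  refine ⟨⟨h, ?_⟩, hfg⟩
  rw [← continuousOn_univ, ← hcover]
  exact hsupport.union_of_isClosed hzero isClosed_closure
    (isClosed_eq g.continuous continuous_const)

lemma dense_preimage_val_closure (S : Set X) : Dense ((↑) ⁻¹' S : Set (closure S)) := by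
  simp [Subtype.dense_iff, inter_eq_right.2 (subset_closure (s := S))]

lemma IsRelativelyPseudocompact.isBounded_image_preimage_val {g : C(X, ℝ)}
    (hg : IsRelativelyPseudocompact {x | g x ≠ 0}) (f : C(closure {x | g x ≠ 0}, ℝ)) :
    IsBounded (f '' ((↑) ⁻¹' {x | g x ≠ 0})) := by
  by_contra hunbdd
  have hlarge (n : ℕ) : ∃ x : closure {x | g x ≠ 0}, g x ≠ 0 ∧ n ≤ |f x| := by
    by_contra! hn
    exact hunbdd ((Metric.isBounded_closedBall (x := (0 : ℝ)) (r := n)).subset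
      (image_subset_iff.2 fun x hx => by simpa using (hn x hx).le))
  choose x hgx hfx using hlarge
  -- `F` grows so fast that `F (|f|) * g` stays unbounded along `x`, although `g` may vanish there.
  obtain ⟨F, hF⟩ := exists_continuous_ge_of_natCast_le fun n => n / |g (x n)|
  obtain ⟨h, hh⟩ := exists_continuous_eq_mul_of_closure_support g
    ⟨fun y => F |f y|, by fun_prop⟩
  obtain ⟨M, hM⟩ := (hg h).exists_norm_le
  obtain ⟨n, hn⟩ := exists_nat_gt M
  refine hn.not_ge (le_trans ?_ (hM _ (mem_image_of_mem h (hgx n))))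
  calc (n : ℝ) ≤ F |f (x n)| * |g (x n)| := (div_le_iff₀ (abs_pos.2 (hgx n))).1 (hF n _ (hfx n))
    _ = F |f (x n)| * ‖g (x n)‖ := rfl
    _ ≤ ‖F |f (x n)|‖ * ‖g (x n)‖ := by gcongr; exact Real.le_norm_self _
    _ = ‖h (x n)‖ := by rw [hh, norm_mul]; rfl

lemma IsCozeroSet.isPseudocompactSpace_closure_iff {C : Set X} (hC : IsCozeroSet C) :
    IsPseudocompactSpace (closure C) ↔ IsRelativelyPseudocompact C := by
  constructor
  · intro h f
    refine (h (f.restrict (closure C))).subset ?_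
    rintro _ ⟨x, hx, rfl⟩
    exact ⟨⟨x, subset_closure hx⟩, rfl⟩
  · obtain ⟨g, rfl⟩ := hC
    exact fun hg f =>
      (hg.isBounded_image_preimage_val f).closure.subset
        (f.continuous.range_subset_closure_image_dense (dense_preimage_val_closure _))

end Pseudocompact

section ZeroSetsAt

variable {X : Type u} [TopologicalSpace X] {p : StoneCech X}

/-- The zero-sets of `X` whose closure in `βX` contains `p`; the Gelfand–Kolmogorov theorem
identifies these families with the z-ultrafilters in `X`. -/
def zeroSetsAt (p : StoneCech X) : Set (Set X) :=
  {Z | IsZeroSet Z ∧ p ∈ closure (stoneCechUnit '' Z)}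

lemma preimage_mem_zeroSetsAt {V : Set (StoneCech X)} (hV : IsZeroSet V) (hVp : V ∈ 𝓝 p) :
    stoneCechUnit ⁻¹' V ∈ zeroSetsAt p := by
  refine ⟨hV.preimage continuous_stoneCechUnit, ?_⟩
  rw [← univ_inter (stoneCechUnit ⁻¹' V)]
  refine mem_closure_image_inter_preimage_of_mem_nhds ?_ hVp
  rw [image_univ]
  exact denseRange_stoneCechUnit p

lemma isZFilter_zeroSetsAt (p : StoneCech X) : IsZFilter (zeroSetsAt p) where
  isZeroSet _ hZ := hZ.1
  nonempty := ⟨_, preimage_mem_zeroSetsAt ⟨0, by simp⟩ univ_mem⟩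
  empty_notMem h := by simpa using h.2
  inter_mem _ hZ _ hW := ⟨hZ.1.inter hW.1, by
    rw [hZ.1.closure_image_inter hW.1]
    exact ⟨hZ.2, hW.2⟩⟩
  mem_of_superset _ hZ _ hW hZW := ⟨hW, closure_mono (image_mono hZW) hZ.2⟩

lemma isZUltrafilter_zeroSetsAt (p : StoneCech X) : IsZUltrafilter (zeroSetsAt p) := by
  refine ⟨isZFilter_zeroSetsAt p, fun G hG hpG Z hZ => ⟨hG.isZeroSet Z hZ, ?_⟩⟩
  by_contra hp
  obtain ⟨V, hVp, hV, hVU⟩ :=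
    exists_isZeroSet_subset_of_mem_nhds (isClosed_closure.isOpen_compl.mem_nhds hp)
  have hdisj : Disjoint Z (stoneCechUnit ⁻¹' V) := disjoint_left.2 fun x hxZ hxV =>
    hVU hxV (subset_closure (mem_image_of_mem _ hxZ))
  exact hG.empty_notMem
    (hdisj.inter_eq ▸ hG.inter_mem Z hZ _ (hpG (preimage_mem_zeroSetsAt hV hVp)))

lemma IsZFilter.exists_subset_zeroSetsAt {F : Set (Set X)} (hF : IsZFilter F) :
    ∃ p, F ⊆ zeroSetsAt p := by
  have : Nonempty F := hF.nonempty.to_subtype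
  have hne (Z : F) : (Z : Set X).Nonempty :=
    nonempty_iff_ne_empty.2 fun h => hF.empty_notMem (h ▸ Z.2)
  obtain ⟨p, hp⟩ := IsCompact.nonempty_iInter_of_directed_nonempty_isCompact_isClosed
    (fun Z : F => closure (stoneCechUnit '' (Z : Set X)))
    (fun Z W => ⟨⟨Z ∩ W, hF.inter_mem Z Z.2 W W.2⟩,
      closure_mono (image_mono inter_subset_left), closure_mono (image_mono inter_subset_right)⟩)
    (fun Z => ((hne Z).image _).closure) (fun _ => isClosed_closure.isCompact)
    (fun _ => isClosed_closure)
  exact ⟨p, fun Z hZ => ⟨hF.isZeroSet Z hZ, mem_iInter.1 hp ⟨Z, hZ⟩⟩⟩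

theorem isZUltrafilter_iff_exists_eq_zeroSetsAt {F : Set (Set X)} :
    IsZUltrafilter F ↔ ∃ p, F = zeroSetsAt p := by
  constructor
  · intro hF
    obtain ⟨p, hp⟩ := hF.prop.exists_subset_zeroSetsAt
    exact ⟨p, hF.eq_of_subset (isZFilter_zeroSetsAt p) hp⟩
  · rintro ⟨p, rfl⟩
    exact isZUltrafilter_zeroSetsAt p

lemma isFreeFamily_zeroSetsAt_iff : IsFreeFamily (zeroSetsAt p) ↔ p ∉ copyInBeta X := by
  constructor
  · rintro hfree ⟨x, rfl⟩
    refine (hfree ▸ notMem_empty x : x ∉ ⋂₀ zeroSetsAt (stoneCechUnit x)) fun Z hZ => ?_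
    exact hZ.1.preimage_closure_image_stoneCechUnit.subset hZ.2
  · refine fun hp => eq_empty_of_forall_notMem fun x hx => ?_
    obtain ⟨V, hVp, hV, hVU⟩ := exists_isZeroSet_subset_of_mem_nhds
      (isOpen_compl_singleton.mem_nhds fun h : p = stoneCechUnit x => hp ⟨x, h.symm⟩)
    exact hVU (hx _ (preimage_mem_zeroSetsAt hV hVp)) rfl

lemma hasCountableIntersectionProperty_zeroSetsAt_iff :
    HasCountableIntersectionProperty (zeroSetsAt p) ↔ p ∈ hewittRealcompactification X := by
  rw [mem_hewittRealcompactification_iff]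
  constructor
  · rintro hcip _ ⟨h, rfl⟩ hp
    have hmem (n : ℕ) : stoneCechUnit ⁻¹' {q | |h q| ≤ 1 / (n + 1)} ∈ zeroSetsAt p := by
      have hlt : |h p| < 1 / (n + 1 : ℝ) := by
        rw [show h p = 0 from hp, abs_zero]
        positivity
      exact preimage_mem_zeroSetsAt
        ((isZeroSet_of_isClosed isClosed_Iic).preimage h.continuous.abs)
        (h.continuous.abs.continuousAt.eventually (ge_mem_nhds hlt))
    obtain ⟨x, hx⟩ := hcip _ (range_subset_iff.2 hmem) (countable_range _)
    refine ⟨stoneCechUnit x, abs_nonpos_iff.1 ?_, x, rfl⟩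
    exact ge_of_tendsto' tendsto_one_div_add_atTop_nhds_zero_nat fun n =>
      hx _ (mem_range_self n)
  · intro h S hS hcount
    have : Countable S := hcount.to_subtype
    choose Z' hZ' hpre using fun Z : S => (hS Z.2).1.exists_preimage_stoneCechUnit_eq
    have hp (Z : S) : p ∈ Z' Z := by
      refine closure_minimal ?_ (hZ' Z).isClosed (hS Z.2).2
      rw [image_subset_iff, hpre]
    obtain ⟨_, hx, x, rfl⟩ := h _ (IsZeroSet.iInter hZ') (mem_iInter.2 hp)
    exact ⟨x, fun Z hZ => (hpre ⟨Z, hZ⟩).subset (mem_iInter.1 hx _)⟩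

theorem mem_interior_hewittRealcompactification_iff :
    p ∈ interior (hewittRealcompactification X) ↔
      ∃ Z ∈ zeroSetsAt p, ∃ C, IsCozeroSetWithPseudocompactClosure C ∧ Z ⊆ C := by
  constructor
  · intro hp
    obtain ⟨V, hVp, C, hV, hC, hVC, hCU⟩ := exists_isZeroSet_subset_isCozeroSet_of_mem_nhds
      (mem_interior_iff_mem_nhds.1 hp)
    have hC' := hC.preimage continuous_stoneCechUnit
    refine ⟨_, preimage_mem_zeroSetsAt hV hVp, _, ⟨hC', ?_⟩, preimage_mono hVC⟩
    rw [hC'.isPseudocompactSpace_closure_iff,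
      ← closure_image_subset_hewittRealcompactification_iff]
    exact (closure_mono (image_preimage_subset _ _)).trans hCU
  · rintro ⟨Z, ⟨hZ, hpZ⟩, C, ⟨hC, hCpc⟩, hZC⟩
    rw [hC.isPseudocompactSpace_closure_iff,
      ← closure_image_subset_hewittRealcompactification_iff] at hCpc
    have hcover : closure (stoneCechUnit '' C) ∪ closure (stoneCechUnit '' Cᶜ) = univ := by
      rw [← closure_union, ← image_union, union_compl_self, image_univ,
        denseRange_stoneCechUnit.closure_range]
    have hpC : p ∉ closure (stoneCechUnit '' Cᶜ) :=
      (hZ.disjoint_closure_image_stoneCechUnit (isZeroSet_compl_iff.2 hC)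
        (disjoint_compl_right_iff_subset.2 hZC)).notMem_of_mem_left hpZ
    exact interior_maximal ((compl_subset_iff_union.2 (union_comm _ _ ▸ hcover)).trans hCpc)
      isClosed_closure.isOpen_compl hpC

end ZeroSetsAt

section ZetaExtension

variable {X : Type u} [TopologicalSpace X]

theorem zetaExtension_eq_copyInBeta_iff :
    zetaExtension X = copyInBeta X ↔ IsPseudocompactSpace X := by
  rw [isPseudocompactSpace_iff_hewittRealcompactification_eq_univ, zetaExtension, union_eq_left]
  constructor <;> intro h
  · refine eq_univ_of_forall fun p => by_contra fun hp => hp ?_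
    exact copyInBeta_subset_hewittRealcompactification (h (subset_closure hp))
  · simp [h]

theorem zetaExtension_eq_univ_iff [CompletelyRegularSpace X] :
    zetaExtension X = univ ↔
      ¬∃ C : Set X, IsCozeroSetWithPseudocompactClosure C ∧
        ∃ Z : Set X, IsZeroSet Z ∧ ¬IsCompact Z ∧ Z ⊆ C := by
  rw [zetaExtension, closure_compl, union_comm, ← compl_subset_iff_union, compl_compl]
  constructor
  · rintro h ⟨C, hC, Z, hZ, hZcompact, hZC⟩
    exact hZcompact (hZ.isCompact_iff_closure_image_subset.2 fun p hp =>
      h (mem_interior_hewittRealcompactification_iff.2 ⟨Z, ⟨hZ, hp⟩, C, hC, hZC⟩))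
  · intro h p hp
    obtain ⟨Z, ⟨hZ, hpZ⟩, C, hC, hZC⟩ := mem_interior_hewittRealcompactification_iff.1 hp
    have hZcompact : IsCompact Z := by_contra fun hn => h ⟨C, hC, Z, hZ, hn, hZC⟩
    exact hZ.isCompact_iff_closure_image_subset.1 hZcompact hpZ

theorem zetaExtension_eq_alphaExtension_iff :
    zetaExtension X = alphaExtension X ↔
      hewittRealcompactification X \ copyInBeta X ⊆ interior (hewittRealcompactification X) := by
  have halpha : (alphaExtension X)ᶜ = hewittRealcompactification X \ copyInBeta X := by
    rw [alphaExtension, compl_union, compl_compl, sdiff_eq, inter_comm]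
  have hzeta : (zetaExtension X)ᶜ = interior (hewittRealcompactification X) \ copyInBeta X := by
    rw [zetaExtension, compl_union, closure_compl, compl_compl, sdiff_eq, inter_comm]
  have hle : alphaExtension X ⊆ zetaExtension X := union_subset_union_right _ subset_closure
  rw [Subset.antisymm_iff, and_iff_left hle, ← compl_subset_compl, halpha, hzeta, subset_sdiff,
    and_iff_left disjoint_sdiff_left]

theorem sdiff_copyInBeta_subset_interior_iff :
    hewittRealcompactification X \ copyInBeta X ⊆ interior (hewittRealcompactification X) ↔
      ∀ F : Set (Set X), IsZUltrafilter F → IsFreeFamily F →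
        HasCountableIntersectionProperty F →
          ∃ Z ∈ F, ∃ C : Set X, IsCozeroSetWithPseudocompactClosure C ∧ Z ⊆ C := by
  simp only [isZUltrafilter_iff_exists_eq_zeroSetsAt, forall_exists_index, forall_eq_apply_imp_iff,
    isFreeFamily_zeroSetsAt_iff, hasCountableIntersectionProperty_zeroSetsAt_iff,
    ← mem_interior_hewittRealcompactification_iff]
  exact ⟨fun h p hpX hp => h ⟨hp, hpX⟩, fun h p hp => h p hp.2 hp.1⟩

end ZetaExtension

theorem theorem2p5_general (X : Type u) [TopologicalSpace X] [CompletelyRegularSpace X] :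
    (zetaExtension X = copyInBeta X ↔ IsPseudocompactSpace X) ∧
    (zetaExtension X = Set.univ ↔
      ¬ ∃ C : Set X, IsCozeroSetWithPseudocompactClosure C ∧
        ∃ Z : Set X, IsZeroSet Z ∧ ¬ IsCompact Z ∧ Z ⊆ C) ∧
    List.TFAE [
      zetaExtension X = alphaExtension X,
      hewittRealcompactification X \ copyInBeta X ⊆ interior (hewittRealcompactification X),
      ∀ F : Set (Set X), IsZUltrafilter F → IsFreeFamily F →
        HasCountableIntersectionProperty F →
          ∃ Z ∈ F, ∃ C : Set X, IsCozeroSetWithPseudocompactClosure C ∧ Z ⊆ C] := by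
  refine ⟨zetaExtension_eq_copyInBeta_iff, zetaExtension_eq_univ_iff, ?_⟩
  tfae_have 1 ↔ 2 := zetaExtension_eq_alphaExtension_iff
  tfae_have 2 ↔ 3 := sdiff_copyInBeta_subset_interior_iff
  tfae_finish

theorem theorem2p5 (X : Type u) [TopologicalSpace X] [T35Space X] :
    (zetaExtension X = copyInBeta X ↔ IsPseudocompactSpace X) ∧
    (zetaExtension X = Set.univ ↔
      ¬ ∃ C : Set X, IsCozeroSetWithPseudocompactClosure C ∧
        ∃ Z : Set X, IsZeroSet Z ∧ ¬ IsCompact Z ∧ Z ⊆ C) ∧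
    List.TFAE [
      zetaExtension X = alphaExtension X,
      hewittRealcompactification X \ copyInBeta X ⊆ interior (hewittRealcompactification X),
      ∀ F : Set (Set X), IsZUltrafilter F → IsFreeFamily F →
        HasCountableIntersectionProperty F →
          ∃ Z ∈ F, ∃ C : Set X, IsCozeroSetWithPseudocompactClosure C ∧ Z ⊆ C] :=
  theorem2p5_general X
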